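/- Let $C>0$, $C\neq1$, and $\xi\in\mathbb R$. On $\mathbb C^9$, with points $(M,N,S)$, $M,N,S\in\mathbb C^3$, consider the system $$\dot M=[M,W]+3[S,IS]+\xi\langle L,N\rangle[L,N],\qquad \dot N=[N,W],\qquad \dot S=[S,W-N],$$ where $[\cdot,\cdot]$ is the vector product, $\langle\cdot,\cdot\rangle$ the bilinear scalar product, $I=\mathrm{diag}(1,1,C)$, $W=I^{-1}M$ and $L=(0,0,1)$. Let $$\Pi=\{M_2=M_3=N_2=N_3=S_1=0,\ N_1=1,\ \langle S,S\rangle=\langle N,N\rangle=1,\ \langle N,S\rangle=0\}\subset\mathbb C^9,$$ which is an invariant complex surface with coordinates $(M_1,S_2,S_3)$, $S_2^2+S_3^2=1$, and let $\omega=\sqrt{3|C-1|}$. For real $k$ let $\Gamma_k\subset\Pi$ be the complex phase curve (the set of all points reached by analytic continuation in complex time, with the subspace topology) of the solution $\Phi(t,k)$ with $$\Phi(0,k):\ (M_1,S_2,S_3)=(1+\omega k,-1,0)\ \text{ if } C>1,\qquad (M_1,S_2,S_3)=(1+\omega k,0,1)\ \text{ if } C<1,$$ that is, $(M_1,S_2,S_3)=(1+\omega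 k\,\mathrm{cn}(\omega t,k),-\mathrm{dn}(\omega t,k),k\,\mathrm{sn}(\omega t,k))$ if $C>1$ and $(1+\omega k\,\mathrm{cn}(\omega t,k),k\,\mathrm{sn}(\omega t,k),\mathrm{dn}(\omega t,k))$ if $C<1$. Let $\operatorname{Re}\Gamma_1$ be the union of all real phase curves in $\Pi$ that are heteroclinic between the two equilibria of the system in $\Pi$ that are hyperbolic within the real part of $\Pi$ (these are $M_1=1$, $(S_2,S_3)=(0,\pm1)$ if $C>1$, and $M_1=1$, $(S_2,S_3)=(\mp1,0)$ if $C<1$), and let $\Omega$ be its closure. Then for every neighbourhood $U\subset\Pi$ of $\Omega$ in $\Pi$ there is $\varepsilon>0$ such that for every real $k$ with $0<|k-1|<\varepsilon$ the fundamental group of $\Gamma_k$ is generated by loops lying in $U$: there is a base point $p\in\Gamma_k\cap U$ such that $\pi_1(\Gamma_k,p)$ is generated by the classes of loops in $\Gamma_k$ based at $p$ whose image lies in $U$. -/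

import Mathlib

open Filter Topology Matrix

namespace Satellite

/-- Complexified phase space `ℂ⁹`: triples `(M, N, S)` of vectors of `ℂ³`. -/
abbrev State : Type := (Fin 3 → ℂ) × (Fin 3 → ℂ) × (Fin 3 → ℂ)

/-- The symmetry axis `L = (0, 0, 1)`. -/
def axisL : Fin 3 → ℂ := ![0, 0, 1]

/-- The inertia tensor `I = diag(1, 1, C)` applied to a vector. -/
noncomputable def inertia (C : ℝ) (x : Fin 3 → ℂ) : Fin 3 → ℂ := ![x 0, x 1, (C : ℂ) * x 2]

/-- `I⁻¹ = diag(1, 1, 1 / C)` applied to a vector. -/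
noncomputable def inertiaInv (C : ℝ) (x : Fin 3 → ℂ) : Fin 3 → ℂ := ![x 0, x 1, x 2 / (C : ℂ)]

/-- The right-hand side of the equations of rotational motion
`M' = [M, W] + 3 [S, I S] + ξ ⟨L, N⟩ [L, N]`, `N' = [N, W]`, `S' = [S, W - N]`,
where `W = I⁻¹ M` is the angular velocity. -/
noncomputable def field (C ξ : ℝ) (x : State) : State :=
  let M := x.1
  let N := x.2.1
  let S := x.2.2
  let W := inertiaInv C M
  (crossProduct M W + (3 : ℂ) • crossProduct S (inertia C S)
      + ((ξ : ℂ) * (axisL ⬝ᵥ N)) • crossProduct axisL N,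
    crossProduct N W,
    crossProduct S (W - N))

/-- The complexified symplectic leaf `⟨S, S⟩ = 1`, `⟨N, N⟩ = 1`, `⟨N, S⟩ = 0`. -/
def leaf : Set State :=
  {x | x.2.2 ⬝ᵥ x.2.2 = 1 ∧ x.2.1 ⬝ᵥ x.2.1 = 1 ∧ x.2.1 ⬝ᵥ x.2.2 = 0}

/-- The invariant manifold `M₂ = M₃ = N₂ = N₃ = S₁ = 0`, `N₁ = 1` (planar rotations). -/
def planar : Set State :=
  {x | x.1 1 = 0 ∧ x.1 2 = 0 ∧ x.2.1 1 = 0 ∧ x.2.1 2 = 0 ∧ x.2.2 0 = 0 ∧ x.2.1 0 = 1}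

/-- The invariant complex surface `Π`. -/
def surfacePi : Set State := planar ∩ leaf

/-- The point of the planar manifold with coordinates `(M₁, S₂, S₃)`. -/
def planarPoint (m s₂ s₃ : ℂ) : State := (![m, 0, 0], ![1, 0, 0], ![0, s₂, s₃])

/-- `ω = √(3 |C - 1|)`. -/
noncomputable def omega (C : ℝ) : ℝ := Real.sqrt (3 * |C - 1|)

/-- The initial value `Φ(0, k)` of the particular solution `Φ(t, k)`, which in the coordinates
`(M₁, S₂, S₃)` is `(1 + ω k cn(ωt, k), -dn(ωt, k), k sn(ωt, k))` if `C > 1` and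
`(1 + ω k cn(ωt, k), k sn(ωt, k), dn(ωt, k))` if `C < 1`; here `sn 0 = 0`, `cn 0 = dn 0 = 1`. -/
noncomputable def initialPoint (C k : ℝ) : State :=
  if 1 < C then planarPoint (1 + omega C * k) (-1) 0
  else planarPoint (1 + omega C * k) 0 1

/-- `x` and `y` lie on one holomorphic solution of `z' = v z` whose complex time runs through a
connected open set. -/
def OnCommonSolution (v : State → State) (x y : State) : Prop :=
  ∃ (D : Set ℂ) (φ : ℂ → State), IsOpen D ∧ IsPreconnected D ∧
    (∀ t ∈ D, HasDerivAt φ (v (φ t)) t) ∧ (∃ t ∈ D, φ t = x) ∧ (∃ t ∈ D, φ t = y)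

/-- The complex phase curve through `x`: all points reached from `x` by analytic continuation of
the solution of `z' = v z` that starts at `x`. -/
def phaseCurve (v : State → State) (x : State) : Set State :=
  {y | Relation.ReflTransGen (OnCommonSolution v) x y}

/-- The phase curve `Γ_k` of the particular solution `Φ(t, k)`. -/
noncomputable def Gam (C ξ k : ℝ) : Set State := phaseCurve (field C ξ) (initialPoint C k)

/-- The equilibria that are hyperbolic in the real part of `Π`: `u_± : M₁ = 1, S = (0, 0, ±1)` if
`C > 1`, and `s_± : M₁ = 1, S = (0, ∓1, 0)` if `C < 1`. -/
noncomputable def hyperbolicEquilibria (C : ℝ) : Set State :=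
  if 1 < C then {planarPoint 1 0 1, planarPoint 1 0 (-1)}
  else {planarPoint 1 (-1) 0, planarPoint 1 1 0}

/-- All nine coordinates are real. -/
def IsRealState (x : State) : Prop :=
  ∀ i, (x.1 i).im = 0 ∧ (x.2.1 i).im = 0 ∧ (x.2.2 i).im = 0

/-- `Re Γ_1`: the union of the real phase curves in `Π` that are heteroclinic, that is, that join
two different hyperbolic equilibria. -/
def reGamOne (C ξ : ℝ) : Set State :=
  {x | ∃ c : ℝ → State, (∀ t, c t ∈ surfacePi ∧ IsRealState (c t)) ∧
    (∀ t, HasDerivAt c (field C ξ (c t)) t) ∧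
    (∃ e₁ ∈ hyperbolicEquilibria C, ∃ e₂ ∈ hyperbolicEquilibria C, e₁ ≠ e₂ ∧
      Tendsto c atBot (𝓝 e₁) ∧ Tendsto c atTop (𝓝 e₂)) ∧
    ∃ t, c t = x}

/-- `Ω`, the closure of `Re Γ_1`. -/
def omegaSet (C ξ : ℝ) : Set State := closure (reGamOne C ξ)

/-- `U` is a complex neighbourhood of the set `K` in the surface `Π`. -/
def IsNeighbourhoodInPi (U K : Set State) : Prop :=
  U ⊆ surfacePi ∧ ∃ V : Set State, IsOpen V ∧ K ⊆ V ∧ V ∩ surfacePi ⊆ U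

/-- The fundamental group of the space `X` is generated by (the classes of) loops lying in `U`:
for some base point in `X ∩ U`, the loops at this point that lie in `U` generate. -/
def GeneratedByLoopsIn (X U : Set State) : Prop :=
  ∃ p : X, (p : State) ∈ U ∧
    Subgroup.closure {g : FundamentalGroup X p | ∃ γ : Path p p,
      (∀ s, (γ s : State) ∈ U) ∧ g = FundamentalGroup.fromPath (Path.Homotopic.Quotient.mk γ)} = ⊤

end Satellite

/-! In rescaled coordinates `(y, v, s)` on Π the phase curve lies on the affine elliptic curve v² +
y² = k², s² + y² = 1, a branched cover of the y-plane with branch points ±1, ±k on the real axis.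
Put R = max(1, k). The linear homotopy that flattens the y-plane onto the segment [-R, R] lifts to
this curve. Along it each of v, s can be followed as a square root whose real and imaginary parts
keep their signs (`rootCompatible_squeeze`, `continuous_followRoot`). Points over y = 0, such as the
initial point, stay fixed. Hence every loop is homotopic, with fixed base point, to a loop over the
segment (`generatedByLoopsIn_of_homotopy`).

For k = 1 the points over the segment form the two real circles v = ±s, which consist of the
heteroclinic orbits and their limits, so they lie in Ω (`embed_mem_omegaSet`). By compactness, for k
near 1 the points over the segment lie in the given neighbourhood (`exists_embed_mem_of_near_one`).

The homotopy must also stay inside the phase curve. For k > 0, k ≠ 1 the elliptic curve is smooth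
and is swept out locally by solutions. Uniqueness then confines phase curves to it
(`phaseCurve_subset_curveImage`), and a path in it never leaves a phase curve
(`mem_phaseCurve_of_path`). -/

namespace Satellite

/-! ### Local uniqueness and existence of holomorphic solutions -/

/-- Two holomorphic solutions of `z' = v z` with the same value at `t₀` agree near `t₀`. -/
theorem eventuallyEq_of_hasDerivAt {E : Type*} [NormedAddCommGroup E] [NormedSpace ℂ E]
    {v : E → E} (hv : ContDiff ℂ 1 v) {φ ψ : ℂ → E} {t₀ : ℂ}
    (hφ : ∀ᶠ t in 𝓝 t₀, HasDerivAt φ (v (φ t)) t) (hψ : ∀ᶠ t in 𝓝 t₀, HasDerivAt ψ (v (ψ t)) t)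
    (h₀ : φ t₀ = ψ t₀) : φ =ᶠ[𝓝 t₀] ψ := by
  obtain ⟨K, s, hs, hK⟩ := hv.contDiffAt.exists_lipschitzOnWith (x := φ t₀)
  have hφs : ∀ᶠ t in 𝓝 t₀, φ t ∈ s := hφ.self_of_nhds.continuousAt hs
  have hψs : ∀ᶠ t in 𝓝 t₀, ψ t ∈ s := hψ.self_of_nhds.continuousAt (h₀ ▸ hs)
  obtain ⟨r, hr, hball⟩ := Metric.eventually_nhds_iff_ball.1 (hφ.and (hψ.and (hφs.and hψs)))
  filter_upwards [Metric.ball_mem_nhds t₀ hr] with t ht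
  -- Reduction to real time: along the segment from `t₀` to `t` both functions solve x' = (t - t₀)
  -- v(x), so the real uniqueness theorem applies.
  have hmem : ∀ τ ∈ Set.Icc (0 : ℝ) 1, t₀ + (τ : ℂ) * (t - t₀) ∈ Metric.ball t₀ r := by
    intro τ hτ
    rw [mem_ball_iff_norm] at ht ⊢
    rw [add_sub_cancel_left, norm_mul, Complex.norm_real, Real.norm_of_nonneg hτ.1]
    exact (mul_le_of_le_one_left (norm_nonneg _) hτ.2).trans_lt ht
  have hline : ∀ τ : ℝ, HasDerivAt (fun τ : ℝ => t₀ + (τ : ℂ) * (t - t₀)) (t - t₀) τ := by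
    intro τ
    simpa using ((Complex.ofRealCLM.hasDerivAt (x := τ)).mul_const (t - t₀)).const_add t₀
  have hder : ∀ χ : ℂ → E, (∀ t ∈ Metric.ball t₀ r, HasDerivAt χ (v (χ t)) t) →
      ∀ τ ∈ Set.Icc (0 : ℝ) 1, HasDerivAt (fun τ : ℝ => χ (t₀ + (τ : ℂ) * (t - t₀)))
        ((t - t₀) • v (χ (t₀ + (τ : ℂ) * (t - t₀)))) τ :=
    fun χ hχ τ hτ => (hχ _ (hmem τ hτ)).scomp τ (hline τ)
  have hφ' := hder φ fun t ht => (hball t ht).1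
  have hψ' := hder ψ fun t ht => (hball t ht).2.1
  have key := ODE_solution_unique_of_mem_Icc_right (v := fun _ x => (t - t₀) • v x)
    (s := fun _ => s) (K := ‖t - t₀‖₊ * K) (a := 0) (b := 1)
    (fun _ _ => LipschitzOnWith.of_dist_le_mul fun x hx y hy => by
      rw [dist_smul₀, NNReal.coe_mul, mul_assoc]
      exact mul_le_mul_of_nonneg_left (hK.dist_le_mul x hx y hy) (norm_nonneg _))
    (fun τ hτ => (hφ' τ hτ).continuousAt.continuousWithinAt)
    (fun τ hτ => (hφ' τ ⟨hτ.1, hτ.2.le⟩).hasDerivWithinAt)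
    (fun τ hτ => (hball _ (hmem τ ⟨hτ.1, hτ.2.le⟩)).2.2.1)
    (fun τ hτ => (hψ' τ hτ).continuousAt.continuousWithinAt)
    (fun τ hτ => (hψ' τ ⟨hτ.1, hτ.2.le⟩).hasDerivWithinAt)
    (fun τ hτ => (hball _ (hmem τ ⟨hτ.1, hτ.2.le⟩)).2.2.2) (by simpa using h₀)
  simpa using key (Set.right_mem_Icc.2 zero_le_one)

/-- A holomorphic function with a nonzero value `w₀ ^ 2` at `z₀` has a holomorphic square root
near `z₀`, unique near `(z₀, w₀)`. -/
theorem exists_local_sqrt {p p' : ℂ → ℂ} {z₀ w₀ : ℂ} (hp : ∀ z, HasDerivAt p (p' z) z)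
    (hw : w₀ ≠ 0) (h₀ : w₀ ^ 2 = p z₀) :
    ∃ A : ℂ → ℂ, A z₀ = w₀ ∧
      (∀ᶠ z in 𝓝 z₀, A z ≠ 0 ∧ A z ^ 2 = p z ∧ HasDerivAt A (p' z / (2 * A z)) z) ∧
      ∀ᶠ q : ℂ × ℂ in 𝓝 (z₀, w₀), q.2 ^ 2 = p q.1 → q.2 = A q.1 := by
  -- Division by w₀² moves the value at z₀ to 1, where the principal logarithm is holomorphic.
  set A : ℂ → ℂ := fun z => w₀ * Complex.exp (Complex.log (p z / w₀ ^ 2) / 2) with hA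
  have hw2 : w₀ ^ 2 ≠ 0 := pow_ne_zero 2 hw
  have hA₀ : A z₀ = w₀ := by simp [hA, ← h₀, div_self hw2]
  have hAne : ∀ z, A z ≠ 0 := fun z => mul_ne_zero hw (Complex.exp_ne_zero _)
  have hcont : ContinuousAt (fun z => p z / w₀ ^ 2) z₀ := (hp z₀).continuousAt.div_const _
  have hslit : ∀ᶠ z in 𝓝 z₀, p z / w₀ ^ 2 ∈ Complex.slitPlane := by
    apply hcont
    apply Complex.isOpen_slitPlane.mem_nhds
    simp [← h₀, div_self hw2]
  have hloc : ∀ᶠ z in 𝓝 z₀,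
      A z ≠ 0 ∧ A z ^ 2 = p z ∧ HasDerivAt A (p' z / (2 * A z)) z := by
    filter_upwards [hslit] with z hz
    have hne : p z / w₀ ^ 2 ≠ 0 := Complex.slitPlane_ne_zero hz
    have hsq : A z ^ 2 = p z := by
      simp only [hA]
      rw [mul_pow, ← Complex.exp_nat_mul]
      push_cast
      rw [mul_div_cancel₀ _ two_ne_zero, Complex.exp_log hne, mul_div_cancel₀ _ hw2]
    refine ⟨hAne z, hsq, ?_⟩
    have hd := ((((hp z).div_const (w₀ ^ 2)).clog hz).div_const 2).cexp.const_mul w₀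
    refine hd.congr_deriv ?_
    have hpne : p z ≠ 0 := fun h => hne (by simp [h])
    have h2 : w₀ * Complex.exp (Complex.log (p z / w₀ ^ 2) / 2) = A z := rfl
    rw [← mul_assoc, h2]
    have := hAne z
    field_simp
    rw [hsq, mul_comm]
  refine ⟨A, hA₀, hloc, ?_⟩
  have hAc : ContinuousAt A z₀ := hloc.self_of_nhds.2.2.continuousAt
  have hfst : Tendsto Prod.fst (𝓝 (z₀, w₀)) (𝓝 z₀) := continuousAt_fst
  have hsum : ContinuousAt (fun q : ℂ × ℂ => q.2 + A q.1) (z₀, w₀) :=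
    continuousAt_snd.add (ContinuousAt.comp (f := Prod.fst) (x := (z₀, w₀)) hAc continuousAt_fst)
  -- Two roots of the same number differ by a sign; the sign -1 is excluded since the sum is close
  -- to 2w₀ ≠ 0.
  have hsum_ne : ∀ᶠ q : ℂ × ℂ in 𝓝 (z₀, w₀), q.2 + A q.1 ≠ 0 := by
    apply hsum.eventually_ne
    simpa [hA₀, ← two_mul] using hw
  filter_upwards [hsum_ne, hfst.eventually hloc] with q hq hq' hsq
  have : (q.2 - A q.1) * (q.2 + A q.1) = 0 := by linear_combination hsq - hq'.2.1
  exact sub_eq_zero.1 ((mul_eq_zero.1 this).resolve_right hq)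

/-- The solutions of `ζ' = c α β`, `α' = c a₁ ζ β`, `β' = c b₁ ζ α` that start at a point of the
curve `α ^ 2 = a₀ + a₁ ζ ^ 2`, `β ^ 2 = b₀ + b₁ ζ ^ 2` with `α, β ≠ 0` sweep out a neighbourhood
of that point in the curve. -/
theorem exists_solution_near {c a₀ a₁ b₀ b₁ z₀ A₀ B₀ : ℂ} (hc : c ≠ 0) (hA₀ : A₀ ≠ 0)
    (hB₀ : B₀ ≠ 0) (hA : A₀ ^ 2 = a₀ + a₁ * z₀ ^ 2) (hB : B₀ ^ 2 = b₀ + b₁ * z₀ ^ 2) :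
    ∀ᶠ q : ℂ × ℂ × ℂ in 𝓝 (z₀, A₀, B₀),
      q.2.1 ^ 2 = a₀ + a₁ * q.1 ^ 2 → q.2.2 ^ 2 = b₀ + b₁ * q.1 ^ 2 →
      ∃ (D : Set ℂ) (ζ α β : ℂ → ℂ), IsOpen D ∧ IsPreconnected D ∧
        (∀ t ∈ D, HasDerivAt ζ (c * α t * β t) t ∧ HasDerivAt α (c * a₁ * ζ t * β t) t ∧
          HasDerivAt β (c * b₁ * ζ t * α t) t ∧
          α t ^ 2 = a₀ + a₁ * ζ t ^ 2 ∧ β t ^ 2 = b₀ + b₁ * ζ t ^ 2) ∧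
        (∃ t ∈ D, (ζ t, α t, β t) = (z₀, A₀, B₀)) ∧ ∃ t ∈ D, (ζ t, α t, β t) = q := by
  have hpoly : ∀ d₀ d₁ z : ℂ, HasDerivAt (fun z : ℂ => d₀ + d₁ * z ^ 2) (2 * d₁ * z) z := by
    intro d₀ d₁ z
    refine ((((hasDerivAt_id z).pow 2).const_mul d₁).const_add d₀).congr_deriv ?_
    simp; ring
  obtain ⟨A, hAz, hAloc, hAuniq⟩ := exists_local_sqrt (hpoly a₀ a₁) hA₀ hA
  obtain ⟨B, hBz, hBloc, hBuniq⟩ := exists_local_sqrt (hpoly b₀ b₁) hB₀ hB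
  obtain ⟨r, hr, hball⟩ := Metric.eventually_nhds_iff_ball.1 (hAloc.and hBloc)
  -- Separation of variables: time is a primitive T of dζ / (cαβ), and the solution is the local
  -- inverse of T.
  have hg : DifferentiableOn ℂ (fun z => (c * A z * B z)⁻¹) (Metric.ball z₀ r) := by
    intro z hz
    obtain ⟨⟨h1, -, h2⟩, h3, -, h4⟩ := hball z hz
    exact (((h2.differentiableAt.const_mul c).mul h4.differentiableAt).inv
      (mul_ne_zero (mul_ne_zero hc h1) h3)).differentiableWithinAt
  obtain ⟨T, hT⟩ := hg.isExactOn_ball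
  have hz₀ : z₀ ∈ Metric.ball z₀ r := Metric.mem_ball_self hr
  have hTne : ∀ z ∈ Metric.ball z₀ r, (c * A z * B z)⁻¹ ≠ 0 := fun z hz =>
    inv_ne_zero (mul_ne_zero (mul_ne_zero hc (hball z hz).1.1) (hball z hz).2.1)
  have hTdiff : DifferentiableOn ℂ T (Metric.ball z₀ r) := fun z hz =>
    (hT z hz).differentiableAt.differentiableWithinAt
  have hTstrict : HasStrictDerivAt T (c * A z₀ * B z₀)⁻¹ z₀ := by
    have := (hTdiff.analyticAt (Metric.isOpen_ball.mem_nhds hz₀)).hasStrictDerivAt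
    rwa [(hT z₀ hz₀).deriv] at this
  let e := ((hTstrict.hasStrictFDerivAt_equiv (hTne z₀ hz₀)).toOpenPartialHomeomorph T).restrOpen
    (Metric.ball z₀ r) Metric.isOpen_ball
  have hsrc : z₀ ∈ e.source :=
    ⟨(hTstrict.hasStrictFDerivAt_equiv (hTne z₀ hz₀)).mem_toOpenPartialHomeomorph_source, hz₀⟩
  have hsrcball : ∀ z ∈ e.source, z ∈ Metric.ball z₀ r := fun z hz => hz.2
  obtain ⟨ρ, hρ, hρt⟩ := Metric.isOpen_iff.1 e.open_target (T z₀) (e.map_source hsrc)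
  have hfst : Tendsto (fun q : ℂ × ℂ × ℂ => q.1) (𝓝 (z₀, A₀, B₀)) (𝓝 z₀) := continuousAt_fst
  have hA' : Tendsto (fun q : ℂ × ℂ × ℂ => (q.1, q.2.1)) (𝓝 (z₀, A₀, B₀)) (𝓝 (z₀, A₀)) :=
    Continuous.tendsto (by fun_prop) _
  have hB' : Tendsto (fun q : ℂ × ℂ × ℂ => (q.1, q.2.2)) (𝓝 (z₀, A₀, B₀)) (𝓝 (z₀, B₀)) :=
    Continuous.tendsto (by fun_prop) _
  filter_upwards [hfst.eventually (e.open_source.mem_nhds hsrc),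
    hfst.eventually ((hT z₀ hz₀).continuousAt (Metric.ball_mem_nhds (T z₀) hρ)),
    hA'.eventually hAuniq, hB'.eventually hBuniq] with q hq1 hq2 hqA hqB hqA2 hqB2
  refine ⟨Metric.ball (T z₀) ρ, e.symm, fun t => A (e.symm t), fun t => B (e.symm t),
    Metric.isOpen_ball, (convex_ball _ _).isPreconnected, ?_, ?_, ?_⟩
  · intro t ht
    have hsy := e.map_target (hρt ht)
    have hb := hsrcball _ hsy
    obtain ⟨⟨h1, hsA, h2⟩, h3, hsB, h4⟩ := hball _ hb
    have hζ : HasDerivAt e.symm (c * A (e.symm t) * B (e.symm t)) t := by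
      simpa using e.hasDerivAt_symm (hρt ht) (hTne _ hb) (hT _ hb)
    refine ⟨hζ, (h2.comp t hζ).congr_deriv ?_, (h4.comp t hζ).congr_deriv ?_, hsA, hsB⟩
    · field_simp
    · field_simp
  · refine ⟨T z₀, Metric.mem_ball_self hρ, ?_⟩
    have : e.symm (T z₀) = z₀ := e.left_inv hsrc
    simp [this, hAz, hBz]
  · refine ⟨T q.1, hq2, ?_⟩
    have : e.symm (T q.1) = q.1 := e.left_inv hq1
    simp only [this]
    rw [← hqA hqA2, ← hqB hqB2]

/-! ### Following a square root continuously -/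

/-- The complex number with square `z` whose real and imaginary parts have the signs of those of
`w`, if there is one. -/
noncomputable def followRoot (w z : ℂ) : ℂ :=
  ⟨SignType.sign w.re * √((‖z‖ + z.re) / 2), SignType.sign w.im * √((‖z‖ - z.re) / 2)⟩

/-- The condition for `followRoot w z` to be a square root of `z`. -/
structure RootCompatible (w z : ℂ) : Prop where
  re_eq_zero : w.re = 0 → ‖z‖ + z.re = 0
  im_eq_zero : w.im = 0 → ‖z‖ - z.re = 0
  nonneg : 0 ≤ w.re * w.im * z.im

/-- The moduli p, q of the real and imaginary parts of a root satisfy p² - q² = Re z and 2pq = |Im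
z|. The signs may be taken from `w`: a sign is zero only where its modulus vanishes, and `nonneg`
makes the product of the signs agree with Im z. -/
theorem RootCompatible.followRoot_sq {w z : ℂ} (h : RootCompatible w z) :
    followRoot w z ^ 2 = z := by
  have h1 : 0 ≤ (‖z‖ + z.re) / 2 := by linarith [(abs_le.1 (Complex.abs_re_le_norm z)).1]
  have h2 : 0 ≤ (‖z‖ - z.re) / 2 := by linarith [(abs_le.1 (Complex.abs_re_le_norm z)).2]
  have hsq1 := Real.sq_sqrt h1
  have hsq2 := Real.sq_sqrt h2
  have hn : ‖z‖ ^ 2 = z.re ^ 2 + z.im ^ 2 := by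
    rw [Complex.sq_norm, Complex.normSq_apply]; ring
  have hpq : 2 * (√((‖z‖ + z.re) / 2) * √((‖z‖ - z.re) / 2)) = |z.im| := by
    rw [← Real.sqrt_mul h1, ← Real.sqrt_sq_eq_abs,
      show (‖z‖ + z.re) / 2 * ((‖z‖ - z.re) / 2) = z.im ^ 2 / 4 by linear_combination hn / 4,
      Real.sqrt_div' _ (by norm_num), show √(4 : ℝ) = 2 by
        rw [show (4 : ℝ) = 2 ^ 2 by norm_num]; exact Real.sqrt_sq (by norm_num)]
    ring
  set p := √((‖z‖ + z.re) / 2) with hp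
  set q := √((‖z‖ - z.re) / 2) with hq
  have hp0 : w.re = 0 → p = 0 := fun h0 => by rw [hp, h.re_eq_zero h0]; simp
  have hq0 : w.im = 0 → q = 0 := fun h0 => by rw [hq, h.im_eq_zero h0]; simp
  have hsp : ((SignType.sign w.re : ℝ) * p) ^ 2 = p ^ 2 := by
    rcases lt_trichotomy w.re 0 with h' | h' | h'
    · simp [sign_neg h']
    · simp [hp0 h']
    · simp [sign_pos h']
  have hsq : ((SignType.sign w.im : ℝ) * q) ^ 2 = q ^ 2 := by
    rcases lt_trichotomy w.im 0 with h' | h' | h'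
    · simp [sign_neg h']
    · simp [hq0 h']
    · simp [sign_pos h']
  have him : 2 * (((SignType.sign w.re : ℝ) * p) * ((SignType.sign w.im : ℝ) * q)) = z.im := by
    have hn := h.nonneg
    rcases lt_trichotomy w.re 0 with h' | h' | h' <;> rcases lt_trichotomy w.im 0 with h'' | h'' | h''
    · have : 0 ≤ z.im := nonneg_of_mul_nonneg_right hn (mul_pos_of_neg_of_neg h' h'')
      rw [abs_of_nonneg this] at hpq
      simp [sign_neg h', sign_neg h'']; linarith
    · have := hq0 h''
      have hz : z.im = 0 := by rw [this] at hpq; simpa using hpq.symm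
      simp [this, hz]
    · have : z.im ≤ 0 := by nlinarith [mul_neg_of_neg_of_pos h' h'']
      rw [abs_of_nonpos this] at hpq
      simp [sign_neg h', sign_pos h'']; linarith
    all_goals try
      have := hp0 h'
      have hz : z.im = 0 := by rw [this] at hpq; simpa using hpq.symm
      simp [this, hz]
    · have : z.im ≤ 0 := by nlinarith [mul_neg_of_pos_of_neg h' h'']
      rw [abs_of_nonpos this] at hpq
      simp [sign_pos h', sign_neg h'']; linarith
    · have := hq0 h''
      have hz : z.im = 0 := by rw [this] at hpq; simpa using hpq.symm
      simp [this, hz]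
    · have : 0 ≤ z.im := nonneg_of_mul_nonneg_right hn (mul_pos h' h'')
      rw [abs_of_nonneg this] at hpq
      simp [sign_pos h', sign_pos h'']; linarith
  apply Complex.ext
  · rw [sq, Complex.mul_re]
    simp only [followRoot, ← hp, ← hq]
    linear_combination hsp - hsq + hsq1 - hsq2
  · rw [sq, Complex.mul_im]
    simp only [followRoot, ← hp, ← hq]
    linear_combination him

theorem followRoot_self (w : ℂ) : followRoot w (w ^ 2) = w := by
  have hn : ‖w ^ 2‖ = w.re ^ 2 + w.im ^ 2 := by
    rw [norm_pow, Complex.sq_norm, Complex.normSq_apply]; ring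
  have hre : (w ^ 2).re = w.re ^ 2 - w.im ^ 2 := by rw [sq, Complex.mul_re]; ring
  apply Complex.ext
  · simp only [followRoot, hn, hre]
    rw [show (w.re ^ 2 + w.im ^ 2 + (w.re ^ 2 - w.im ^ 2)) / 2 = w.re ^ 2 by ring,
      Real.sqrt_sq_eq_abs, sign_mul_abs]
  · simp only [followRoot, hn, hre]
    rw [show (w.re ^ 2 + w.im ^ 2 - (w.re ^ 2 - w.im ^ 2)) / 2 = w.im ^ 2 by ring,
      Real.sqrt_sq_eq_abs, sign_mul_abs]

/-- Where `f` is nonzero its sign is locally constant; at a zero of `f` the product is dominated by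
|g|, which tends to 0. -/
theorem continuous_sign_mul {X : Type*} [TopologicalSpace X] {f g : X → ℝ} (hf : Continuous f)
    (hg : Continuous g) (h : ∀ x, f x = 0 → g x = 0) :
    Continuous fun x => (SignType.sign (f x) : ℝ) * g x := by
  rw [continuous_iff_continuousAt]
  intro x
  by_cases hx : f x = 0
  · have hle : ∀ y, ‖(SignType.sign (f y) : ℝ) * g y‖ ≤ |g y| := by
      intro y
      rcases lt_trichotomy (f y) 0 with h' | h' | h'
      · simp [sign_neg h']
      · simp [h']
      · simp [sign_pos h']
    have hlim : Tendsto (fun y => |g y|) (𝓝 x) (𝓝 0) := by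
      have := (hg.abs.tendsto x)
      rwa [h x hx, abs_zero] at this
    have := squeeze_zero_norm hle hlim
    rw [ContinuousAt, h x hx, mul_zero]
    exact this
  · refine ContinuousAt.mul ?_ hg.continuousAt
    have h1 : ContinuousAt (fun y => SignType.sign (f y)) x :=
      (continuousAt_sign_of_ne_zero hx).comp hf.continuousAt
    exact (continuous_of_discreteTopology (f := fun s : SignType => (s : ℝ))).continuousAt.comp h1

theorem continuous_followRoot {X : Type*} [TopologicalSpace X] {w z : X → ℂ} (hw : Continuous w)
    (hz : Continuous z) (h : ∀ x, RootCompatible (w x) (z x)) :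
    Continuous fun x => followRoot (w x) (z x) := by
  have hre : Continuous fun x => (followRoot (w x) (z x)).re :=
    continuous_sign_mul (g := fun x => √((‖z x‖ + (z x).re) / 2)) (by fun_prop) (by fun_prop)
      fun x hx => by rw [(h x).re_eq_zero hx]; simp
  have him : Continuous fun x => (followRoot (w x) (z x)).im :=
    continuous_sign_mul (g := fun x => √((‖z x‖ - (z x).re) / 2)) (by fun_prop) (by fun_prop)
      fun x hx => by rw [(h x).im_eq_zero hx]; simp
  exact Complex.equivRealProdCLM.symm.continuous.comp (hre.prodMk him)

/-! ### Flattening the y-plane and lifting the homotopy to the curve -/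

/-- The linear homotopy from the identity of `ℂ` to the retraction onto the real segment
`[-R, R]` that forgets the imaginary part and clamps the real part. -/
noncomputable def squeeze (R t : ℝ) (y : ℂ) : ℂ :=
  ⟨(1 - t) * y.re + t * max (-R) (min R y.re), (1 - t) * y.im⟩

theorem squeeze_zero_left (R : ℝ) (y : ℂ) : squeeze R 0 y = y := by
  apply Complex.ext <;> simp [squeeze]

theorem continuous_squeeze (R : ℝ) : Continuous fun x : ℝ × ℂ => squeeze R x.1 x.2 := by
  have : Continuous fun x : ℝ × ℂ =>
      ((1 - x.1) * x.2.re + x.1 * max (-R) (min R x.2.re), (1 - x.1) * x.2.im) := by fun_prop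
  exact Complex.equivRealProdCLM.symm.continuous.comp this

/-- The branch points `±c` of `w ^ 2 = c ^ 2 - y ^ 2` lie in the segment `[-R, R]`, so that a
square root can be followed along `squeeze`. -/
theorem rootCompatible_squeeze {c R t : ℝ} {y w : ℂ} (hc : 0 < c) (hcR : c ≤ R) (ht0 : 0 ≤ t)
    (ht1 : t ≤ 1) (hw : w ^ 2 + y ^ 2 = (c : ℂ) ^ 2) :
    RootCompatible w ((c : ℂ) ^ 2 - squeeze R t y ^ 2) := by
  have hre : w.re ^ 2 - w.im ^ 2 + (y.re ^ 2 - y.im ^ 2) = c ^ 2 := by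
    have := congrArg Complex.re hw
    simp only [sq, Complex.add_re, Complex.mul_re, Complex.ofReal_re, Complex.ofReal_im] at this
    linarith
  have him : w.re * w.im + y.re * y.im = 0 := by
    have := congrArg Complex.im hw
    simp only [sq, Complex.add_im, Complex.mul_im, Complex.ofReal_re, Complex.ofReal_im] at this
    linarith
  -- The homotopy scales Re y by a factor l ≥ 0 which is 1 unless |Re y| > R ≥ c; so Re y never
  -- crosses ±c.
  obtain ⟨l, hl0, hl, hge, hle⟩ : ∃ l : ℝ, 0 ≤ l ∧ (squeeze R t y).re = l * y.re ∧
      (c ≤ |y.re| → c ≤ |l * y.re|) ∧ (|y.re| ≤ c → |l * y.re| ≤ c) := by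
    rcases le_or_gt |y.re| R with h | h
    · obtain ⟨h1, h2⟩ := abs_le.1 h
      refine ⟨1, zero_le_one, ?_, by simp, by simp⟩
      simp only [squeeze, min_eq_right h2, max_eq_right h1]
      ring
    · have hR : 0 < R := hc.trans_le hcR
      have hy : 0 < |y.re| := hR.trans h
      have hl0 : 0 ≤ 1 - t + t * (R / |y.re|) := by
        have : 0 ≤ 1 - t := by linarith
        positivity
      refine ⟨1 - t + t * (R / |y.re|), hl0, ?_, fun _ => ?_, fun h' => by linarith⟩
      · have : max (-R) (min R y.re) = R / |y.re| * y.re := by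
          rcases lt_abs.1 h with h' | h'
          · rw [min_eq_left h'.le, max_eq_right (by linarith), abs_of_pos (by linarith),
              div_mul_cancel₀ _ (hR.trans h').ne']
          · rw [min_eq_right (by linarith), max_eq_left (by linarith), abs_of_neg (by linarith),
              div_neg, neg_mul, div_mul_cancel₀ _ (by linarith : y.re < 0).ne]
        simp only [squeeze, this]
        ring
      · rw [abs_mul, abs_of_nonneg hl0, add_mul, mul_assoc, div_mul_cancel₀ _ hy.ne']
        nlinarith
  have hi : (squeeze R t y).im = (1 - t) * y.im := rfl
  set z := (c : ℂ) ^ 2 - squeeze R t y ^ 2 with hz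
  have hzre : z.re = c ^ 2 - (l * y.re) ^ 2 + ((1 - t) * y.im) ^ 2 := by
    simp only [hz, sq, Complex.sub_re, Complex.mul_re, Complex.ofReal_re, Complex.ofReal_im, hl, hi]
    ring
  have hzim : z.im = -2 * (l * y.re) * ((1 - t) * y.im) := by
    simp only [hz, sq, Complex.sub_im, Complex.mul_im, Complex.ofReal_re, Complex.ofReal_im, hl, hi]
    ring
  have hnorm : z.im = 0 → ‖z‖ = |z.re| := fun h => by
    rw [Complex.norm_def, Complex.normSq_apply, h, mul_zero, add_zero, Real.sqrt_mul_self_eq_abs]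
  refine ⟨fun h0 => ?_, fun h0 => ?_, ?_⟩
  -- If Re w = 0, then c² - y² ≤ 0, so y is real with |y| ≥ c, and this persists along the homotopy.
  · rw [h0] at hre him
    have hy : y.im = 0 := by
      rcases mul_eq_zero.1 (show y.re * y.im = 0 by linarith) with h | h
      · rw [h] at hre; nlinarith [sq_nonneg w.im, sq_nonneg y.im]
      · exact h
    have hcy : c ≤ |y.re| := by
      apply le_of_sq_le_sq _ (abs_nonneg _)
      rw [sq_abs]; rw [hy] at hre; nlinarith [sq_nonneg w.im]
    have h3 := hge hcy
    have h4 : c ^ 2 ≤ (l * y.re) ^ 2 := by rw [← sq_abs (l * y.re)]; gcongr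
    rw [hnorm (by rw [hzim, hy]; ring), abs_of_nonpos (by rw [hzre, hy]; linarith)]
    ring
  -- If Im w = 0, then c² - y² ≥ 0, so y is purely imaginary or is real with |y| ≤ c; both persist.
  · rw [h0] at hre him
    have hzero : z.im = 0 := by
      rw [hzim]; linear_combination (-2 * l * (1 - t)) * him
    have hpos : 0 ≤ z.re := by
      rcases mul_eq_zero.1 (show y.re * y.im = 0 by linarith) with h | h
      · rw [hzre, h]; nlinarith [sq_nonneg c, sq_nonneg ((1 - t) * y.im)]
      · have hcy : |y.re| ≤ c := by
          apply abs_le_of_sq_le_sq _ hc.le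
          rw [h] at hre; nlinarith [sq_nonneg w.re]
        have h4 : (l * y.re) ^ 2 ≤ c ^ 2 := by
          rw [← sq_abs (l * y.re)]; have := hle hcy; gcongr
        rw [hzre]; nlinarith [sq_nonneg ((1 - t) * y.im)]
    rw [hnorm hzero, abs_of_nonneg hpos]; ring
  -- Since Re w · Im w = -Re y · Im y, and Im z is the nonnegative multiple 2l(1 - t) of that same
  -- number, the product is a square times a nonnegative factor.
  · rw [hzim, show w.re * w.im * (-2 * (l * y.re) * ((1 - t) * y.im)) =
      2 * l * (1 - t) * (y.re * y.im) ^ 2 by linear_combination (-2 * l * (1 - t) * y.re * y.im) * him]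
    have : 0 ≤ 1 - t := by linarith
    positivity

/-- The affine elliptic curve `v ^ 2 + y ^ 2 = k ^ 2`, `s ^ 2 + y ^ 2 = 1` of points `(y, v, s)`. -/
def curve (k : ℝ) : Set (ℂ × ℂ × ℂ) :=
  {x | x.2.1 ^ 2 + x.1 ^ 2 = (k : ℂ) ^ 2 ∧ x.2.2 ^ 2 + x.1 ^ 2 = 1}

theorem isClosed_curve (k : ℝ) : IsClosed (curve k) :=
  (isClosed_eq (by fun_prop) (by fun_prop)).inter (isClosed_eq (by fun_prop) (by fun_prop))

/-- The lift of the homotopy `squeeze` of the `y`-plane to the elliptic curve. -/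
noncomputable def deform (k t : ℝ) (x : ℂ × ℂ × ℂ) : ℂ × ℂ × ℂ :=
  (squeeze (max 1 k) t x.1,
    followRoot x.2.1 ((k : ℂ) ^ 2 - squeeze (max 1 k) t x.1 ^ 2),
    followRoot x.2.2 (1 - squeeze (max 1 k) t x.1 ^ 2))

section deform

variable {k t : ℝ} {x : ℂ × ℂ × ℂ}

theorem rootCompatible_fst (hk : 0 < k) (ht0 : 0 ≤ t) (ht1 : t ≤ 1) (hx : x ∈ curve k) :
    RootCompatible x.2.1 ((k : ℂ) ^ 2 - squeeze (max 1 k) t x.1 ^ 2) :=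
  rootCompatible_squeeze hk (le_max_right _ _) ht0 ht1 hx.1

theorem rootCompatible_snd (ht0 : 0 ≤ t) (ht1 : t ≤ 1) (hx : x ∈ curve k) :
    RootCompatible x.2.2 (1 - squeeze (max 1 k) t x.1 ^ 2) := by
  simpa using rootCompatible_squeeze one_pos (le_max_left 1 k) ht0 ht1
    (show x.2.2 ^ 2 + x.1 ^ 2 = ((1 : ℝ) : ℂ) ^ 2 by simpa using hx.2)

theorem deform_mem_curve (hk : 0 < k) (ht0 : 0 ≤ t) (ht1 : t ≤ 1) (hx : x ∈ curve k) :
    deform k t x ∈ curve k := by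
  constructor
  · simp [deform, (rootCompatible_fst hk ht0 ht1 hx).followRoot_sq]
  · simp [deform, (rootCompatible_snd ht0 ht1 hx).followRoot_sq]

theorem deform_zero_left (hx : x ∈ curve k) : deform k 0 x = x := by
  simp only [deform, squeeze_zero_left]
  rw [← hx.1, ← hx.2, add_sub_cancel_right, add_sub_cancel_right, followRoot_self, followRoot_self]

/-- This keeps the base point fixed: the squeezing does not move y = 0, and each followed root is
then the original one. -/
theorem deform_of_fst_eq_zero (hk : 0 < k) (hx : x ∈ curve k) (h0 : x.1 = 0) :
    deform k t x = x := by
  have hR : 0 < max 1 k := lt_max_of_lt_right hk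
  have hs : squeeze (max 1 k) t x.1 = x.1 := by
    rw [h0]
    apply Complex.ext
    · simp only [squeeze, Complex.zero_re]
      rw [min_eq_right hR.le, max_eq_right (by linarith)]; ring
    · simp [squeeze]
  simp only [deform, hs]
  rw [← hx.1, ← hx.2, add_sub_cancel_right, add_sub_cancel_right, followRoot_self, followRoot_self]

theorem continuous_deform (hk : 0 < k) {X : Type*} [TopologicalSpace X] {t : X → ℝ}
    {x : X → ℂ × ℂ × ℂ} (ht : Continuous t) (hx : Continuous x) (ht0 : ∀ a, 0 ≤ t a)
    (ht1 : ∀ a, t a ≤ 1) (hmem : ∀ a, x a ∈ curve k) :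
    Continuous fun a => deform k (t a) (x a) := by
  have hs : Continuous fun a => squeeze (max 1 k) (t a) (x a).1 :=
    (continuous_squeeze _).comp (ht.prodMk hx.fst)
  exact hs.prodMk ((continuous_followRoot (by fun_prop) (by fun_prop)
    fun a => rootCompatible_fst hk (ht0 a) (ht1 a) (hmem a)).prodMk
    (continuous_followRoot (by fun_prop) (by fun_prop)
      fun a => rootCompatible_snd (ht0 a) (ht1 a) (hmem a)))

theorem deform_one_fst_im : (deform k 1 x).1.im = 0 := by simp [deform, squeeze]

theorem abs_deform_one_fst_re_le : |(deform k 1 x).1.re| ≤ max 1 k := by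
  have hR : (0 : ℝ) < max 1 k := lt_max_of_lt_left one_pos
  simp only [deform, squeeze, sub_self, zero_mul, zero_add, one_mul]
  exact abs_le.2 ⟨le_max_left _ _, max_le (by linarith) (min_le_left _ _)⟩

end deform

/-! ### Smoothness of the elliptic curve and its sweeping by solutions -/

/-- Near any of its points the elliptic curve is swept out by a holomorphic solution of
`y' = -l v s`, `v' = l y s`, `s' = l v y`. -/
theorem eventually_exists_solution {k : ℝ} (hk : 0 < k) (hk1 : k ≠ 1) {l : ℂ} (hl : l ≠ 0)
    {x : ℂ × ℂ × ℂ} (hx : x ∈ curve k) :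
    ∀ᶠ q in 𝓝 x, q ∈ curve k → ∃ (D : Set ℂ) (y v s : ℂ → ℂ), IsOpen D ∧ IsPreconnected D ∧
      (∀ t ∈ D, HasDerivAt y (-l * v t * s t) t ∧ HasDerivAt v (l * y t * s t) t ∧
        HasDerivAt s (l * v t * y t) t ∧ (y t, v t, s t) ∈ curve k) ∧
      (∃ t ∈ D, (y t, v t, s t) = x) ∧ ∃ t ∈ D, (y t, v t, s t) = q := by
  obtain ⟨y₀, v₀, s₀⟩ := x
  obtain ⟨h1, h2⟩ := hx
  simp only at h1 h2
  have hk0 : (k : ℂ) ≠ 0 := by exact_mod_cast hk.ne'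
  have hk2 : (k : ℂ) ^ 2 ≠ 1 := by
    norm_cast
    exact fun h => hk1 ((pow_eq_one_iff_of_nonneg hk.le two_ne_zero).1 h)
  -- At a branch point y is not a local parameter, so the vanishing coordinate, v or s, is used
  -- instead. The other two coordinates are then nonzero because k ≠ 0 and k² ≠ 1.
  by_cases hv : v₀ = 0
  · have hy : y₀ ≠ 0 := by
      rintro rfl
      exact pow_ne_zero 2 hk0 (by rw [← h1, hv]; ring)
    have hs : s₀ ≠ 0 := by
      rintro rfl; apply hk2; rw [← h1, ← h2, hv]
    have key := exists_solution_near (a₀ := k ^ 2) (a₁ := -1) (b₀ := 1 - k ^ 2) (b₁ := 1)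
      (z₀ := v₀) hl hy hs (by linear_combination h1) (by linear_combination h2 - h1)
    have hlim : Tendsto (fun q : ℂ × ℂ × ℂ => (q.2.1, q.1, q.2.2)) (𝓝 (y₀, v₀, s₀))
        (𝓝 (v₀, y₀, s₀)) := Continuous.tendsto (by fun_prop) _
    filter_upwards [hlim.eventually key] with q hq hqk
    obtain ⟨D, ζ, α, β, hD, hD', hder, ⟨t₀, ht₀, e₀⟩, t₁, ht₁, e₁⟩ :=
      hq (by linear_combination hqk.1) (by linear_combination hqk.2 - hqk.1)
    simp only [Prod.mk.injEq] at e₀ e₁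
    refine ⟨D, α, ζ, β, hD, hD', fun t ht => ?_, ⟨t₀, ht₀, ?_⟩, t₁, ht₁, ?_⟩
    · obtain ⟨d1, d2, d3, e1, e2⟩ := hder t ht
      exact ⟨d2.congr_deriv (by ring), d1, d3.congr_deriv (by ring),
        by linear_combination e1, by linear_combination e1 + e2⟩
    · simp [e₀]
    · simp [e₁]
  by_cases hs : s₀ = 0
  · have hy : y₀ ≠ 0 := by
      rintro rfl; simp [hs] at h2
    have key := exists_solution_near (a₀ := 1) (a₁ := -1) (b₀ := k ^ 2 - 1) (b₁ := 1)
      (z₀ := s₀) hl hy hv (by linear_combination h2) (by linear_combination h1 - h2)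
    have hlim : Tendsto (fun q : ℂ × ℂ × ℂ => (q.2.2, q.1, q.2.1)) (𝓝 (y₀, v₀, s₀))
        (𝓝 (s₀, y₀, v₀)) := Continuous.tendsto (by fun_prop) _
    filter_upwards [hlim.eventually key] with q hq hqk
    obtain ⟨D, ζ, α, β, hD, hD', hder, ⟨t₀, ht₀, e₀⟩, t₁, ht₁, e₁⟩ :=
      hq (by linear_combination hqk.2) (by linear_combination hqk.1 - hqk.2)
    simp only [Prod.mk.injEq] at e₀ e₁
    refine ⟨D, α, β, ζ, hD, hD', fun t ht => ?_, ⟨t₀, ht₀, ?_⟩, t₁, ht₁, ?_⟩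
    · obtain ⟨d1, d2, d3, e1, e2⟩ := hder t ht
      exact ⟨d2.congr_deriv (by ring), d3.congr_deriv (by ring), d1.congr_deriv (by ring),
        by linear_combination e1 + e2, by linear_combination e1⟩
    · simp [e₀]
    · simp [e₁]
  have key := exists_solution_near (a₀ := k ^ 2) (a₁ := -1) (b₀ := 1) (b₁ := -1)
    (z₀ := y₀) (neg_ne_zero.2 hl) hv hs (by linear_combination h1) (by linear_combination h2)
  filter_upwards [key] with q hq hqk
  obtain ⟨D, ζ, α, β, hD, hD', hder, ht₀, ht₁⟩ :=
    hq (by linear_combination hqk.1) (by linear_combination hqk.2)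
  refine ⟨D, ζ, α, β, hD, hD', fun t ht => ?_, ht₀, ht₁⟩
  obtain ⟨d1, d2, d3, e1, e2⟩ := hder t ht
  exact ⟨d1, d2.congr_deriv (by ring), d3.congr_deriv (by ring),
    by linear_combination e1, by linear_combination e2⟩

/-! ### Deformations and generation of the fundamental group -/

/-- If `X` is deformed, with a fixed point `p`, into `U`, then its fundamental group is generated
by loops in `U`. -/
theorem generatedByLoopsIn_of_homotopy {X U : Set State} (p : X) (H : unitInterval × X → X)
    (hH : Continuous H) (h0 : ∀ x, H (0, x) = x) (hp : ∀ t, H (t, p) = p)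
    (h1 : ∀ x, (H (1, x) : State) ∈ U) : GeneratedByLoopsIn X U := by
  refine ⟨p, hp 1 ▸ h1 p, ?_⟩
  rw [eq_top_iff]
  intro g _
  -- No products are needed: each class is itself represented by a loop in `U`.
  apply Subgroup.subset_closure
  obtain ⟨γ, hγ⟩ := Quotient.exists_rep (FundamentalGroup.toPath g)
  let F : C(unitInterval × unitInterval, X) := ⟨fun a => H (a.1, γ a.2), by fun_prop⟩
  let γ' : Path p p := ⟨⟨fun s => H (1, γ s), by fun_prop⟩, by simp [hp], by simp [hp]⟩
  have hom : Path.Homotopic γ γ' :=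
    ⟨{ toContinuousMap := F
       map_zero_left := fun s => h0 _
       map_one_left := fun s => rfl
       prop' := by
        rintro t s (rfl | rfl)
        · simp [F, hp]
        · simp [F, hp] }⟩
  refine ⟨γ', fun s => h1 _, ?_⟩
  have : Path.Homotopic.Quotient.mk γ' = FundamentalGroup.toPath g := by
    rw [← hγ]; exact (Quotient.sound hom).symm
  rw [this]

/-! ### Coordinates on Π and the reduced system -/

/-- The rescaled coordinates `(y, v, s)` on `Π`: `M₁ = 1 + ω v`, and `(S₂, S₃)` is `(s, y)` if
`C > 1` and `(y, s)` if `C < 1`. -/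
noncomputable def embed (C : ℝ) (x : ℂ × ℂ × ℂ) : State :=
  if 1 < C then planarPoint (1 + omega C * x.2.1) x.2.2 x.1
  else planarPoint (1 + omega C * x.2.1) x.1 x.2.2

/-- The left inverse of `embed`. -/
noncomputable def coords (C : ℝ) (x : State) : ℂ × ℂ × ℂ :=
  if 1 < C then (x.2.2 2, (x.1 0 - 1) / omega C, x.2.2 1)
  else (x.2.2 1, (x.1 0 - 1) / omega C, x.2.2 2)

/-- The orientation of the system in the coordinates `(y, v, s)`. -/
noncomputable def orientation (C : ℝ) : ℝ := if 1 < C then 1 else -1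

theorem omega_pos {C : ℝ} (hC : C ≠ 1) : 0 < omega C :=
  Real.sqrt_pos.2 (mul_pos three_pos (abs_pos.2 (sub_ne_zero.2 hC)))

/-- The coefficient 3(C - 1) of the equation for M₁ changes sign at C = 1. The exchange of the roles
of S₂ and S₃ in `embed` also reverses the sign, so one reduced system serves both cases. -/
theorem orientation_mul_omega_sq (C : ℝ) :
    (orientation C : ℂ) * (omega C : ℂ) ^ 2 = 3 * (C - 1) := by
  have : orientation C * omega C ^ 2 = 3 * (C - 1) := by
    rw [omega, Real.sq_sqrt (by positivity), orientation]
    split_ifs with h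
    · rw [abs_of_pos (by linarith)]; ring
    · rw [abs_of_nonpos (by linarith)]; ring
  exact_mod_cast this

theorem orientation_sq (C : ℝ) : orientation C ^ 2 = 1 := by
  rw [orientation]; split_ifs <;> norm_num

theorem coords_embed {C : ℝ} (hC : C ≠ 1) (x : ℂ × ℂ × ℂ) : coords C (embed C x) = x := by
  have : (omega C : ℂ) ≠ 0 := by exact_mod_cast (omega_pos hC).ne'
  by_cases h : 1 < C <;> simp [coords, embed, h, planarPoint, this]

theorem continuous_planarPoint {X : Type*} [TopologicalSpace X] {m a b : X → ℂ}
    (hm : Continuous m) (ha : Continuous a) (hb : Continuous b) :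
    Continuous fun x => planarPoint (m x) (a x) (b x) := by
  unfold planarPoint
  refine Continuous.prodMk ?_ (Continuous.prodMk ?_ ?_) <;>
    refine continuous_pi fun i => ?_ <;> fin_cases i <;> simp <;> fun_prop

theorem continuous_embed (C : ℝ) : Continuous (embed C) := by
  unfold embed
  split_ifs <;> apply continuous_planarPoint <;> fun_prop

theorem continuous_coords (C : ℝ) : Continuous (coords C) := by
  unfold coords
  split_ifs <;> fun_prop

theorem embed_mem_surfacePi (C : ℝ) {k : ℝ} {x : ℂ × ℂ × ℂ} (hx : x ∈ curve k) :
    embed C x ∈ surfacePi := by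
  have h := hx.2
  unfold embed
  split_ifs
  · refine ⟨by simp [planar, planarPoint], ?_, ?_, ?_⟩ <;>
      simp [planarPoint, dotProduct, Fin.sum_univ_three]
    linear_combination h
  · refine ⟨by simp [planar, planarPoint], ?_, ?_, ?_⟩ <;>
      simp [planarPoint, dotProduct, Fin.sum_univ_three]
    linear_combination h

theorem contDiff_field (C ξ : ℝ) : ContDiff ℂ 1 (field C ξ) := by
  unfold field
  refine ContDiff.prodMk ?_ (ContDiff.prodMk ?_ ?_) <;>
    refine contDiff_pi.2 fun i => ?_ <;> fin_cases i <;>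
    simp [crossProduct, inertia, inertiaInv, axisL, dotProduct, Fin.sum_univ_three,
      div_eq_mul_inv, Matrix.vecHead, Matrix.vecTail] <;>
    fun_prop

/-- The ξ-term drops out because N = (1, 0, 0) is orthogonal to L. -/
theorem field_planarPoint (C ξ : ℝ) (m a b : ℂ) :
    field C ξ (planarPoint m a b) =
      (![3 * (C - 1) * a * b, 0, 0], 0, ![0, b * (m - 1), -a * (m - 1)]) := by
  unfold field planarPoint
  refine Prod.ext ?_ (Prod.ext ?_ ?_) <;> funext i <;> fin_cases i <;>
    simp [crossProduct, inertia, inertiaInv, axisL, dotProduct, Fin.sum_univ_three]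
  ring

section hasDerivAt

variable {𝕜 : Type*} [NontriviallyNormedField 𝕜] [NormedAlgebra 𝕜 ℂ]

theorem hasDerivAt_planarPoint {m a b : 𝕜 → ℂ} {m' a' b' : ℂ} {t : 𝕜} (hm : HasDerivAt m m' t)
    (ha : HasDerivAt a a' t) (hb : HasDerivAt b b' t) :
    HasDerivAt (fun t => planarPoint (m t) (a t) (b t))
      ((![m', 0, 0], 0, ![0, a', b']) : State) t := by
  unfold planarPoint
  refine HasDerivAt.prodMk ?_ (HasDerivAt.prodMk (hasDerivAt_const t _) ?_) <;>
    refine hasDerivAt_pi.2 fun i => ?_ <;> fin_cases i <;> simp [hasDerivAt_const, *]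

/-- The system on `Π` in the coordinates `(y, v, s)`. -/
theorem hasDerivAt_embed (C ξ : ℝ) {y v s : 𝕜 → ℂ} {t : 𝕜}
    (hy : HasDerivAt y (-(orientation C * omega C) * v t * s t) t)
    (hv : HasDerivAt v (orientation C * omega C * y t * s t) t)
    (hs : HasDerivAt s (orientation C * omega C * v t * y t) t) :
    HasDerivAt (fun t => embed C (y t, v t, s t)) (field C ξ (embed C (y t, v t, s t))) t := by
  have hm := (hv.const_mul (omega C : ℂ)).const_add 1
  have key := orientation_mul_omega_sq C
  by_cases h : 1 < C
  · simp only [embed, if_pos h, field_planarPoint]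
    have hσ : (orientation C : ℂ) = 1 := by simp [orientation, h]
    rw [hσ] at hy hv hs hm key
    refine (hasDerivAt_planarPoint hm hs hy).congr_deriv ?_
    refine Prod.ext ?_ (Prod.ext rfl ?_) <;> funext i <;> fin_cases i <;> simp
    · linear_combination y t * s t * key
    · ring
    · ring
  · simp only [embed, if_neg h, field_planarPoint]
    have hσ : (orientation C : ℂ) = -1 := by simp [orientation, h]
    rw [hσ] at hy hv hs hm key
    refine (hasDerivAt_planarPoint hm hy hs).congr_deriv ?_
    refine Prod.ext ?_ (Prod.ext rfl ?_) <;> funext i <;> fin_cases i <;> simp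
    · linear_combination y t * s t * key
    · ring
    · ring

end hasDerivAt

/-! ### Phase curves and the elliptic curve -/

section phaseCurve

variable {C : ℝ} (ξ : ℝ) {k : ℝ}

/-- The copy of the elliptic curve in the phase space. -/
def curveImage (C k : ℝ) : Set State := {x | coords C x ∈ curve k ∧ embed C (coords C x) = x}

theorem embed_mem_curveImage (hC : C ≠ 1) {x : ℂ × ℂ × ℂ} (hx : x ∈ curve k) :
    embed C x ∈ curveImage C k := by
  rw [curveImage, Set.mem_ofPred_eq, coords_embed hC]
  exact ⟨hx, rfl⟩

theorem isClosed_curveImage (C k : ℝ) : IsClosed (curveImage C k) :=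
  ((isClosed_curve k).preimage (continuous_coords C)).inter
    (isClosed_eq ((continuous_embed C).comp (continuous_coords C)) continuous_id)

/-- Near any of its points the elliptic curve is swept out by a holomorphic solution. -/
theorem eventually_exists_solution_curveImage (hC : C ≠ 1) (hk : 0 < k) (hk1 : k ≠ 1) {x : State}
    (hx : x ∈ curveImage C k) :
    ∀ᶠ q in 𝓝 x, q ∈ curveImage C k → ∃ (D : Set ℂ) (φ : ℂ → State),
      IsOpen D ∧ IsPreconnected D ∧
      (∀ t ∈ D, HasDerivAt φ (field C ξ (φ t)) t ∧ φ t ∈ curveImage C k) ∧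
      (∃ t ∈ D, φ t = x) ∧ ∃ t ∈ D, φ t = q := by
  have hl : (orientation C * omega C : ℂ) ≠ 0 := by
    refine mul_ne_zero ?_ (by exact_mod_cast (omega_pos hC).ne')
    have := orientation_sq C
    intro h
    rw [Complex.ofReal_eq_zero] at h
    norm_num [h] at this
  filter_upwards [(continuous_coords C).continuousAt.eventually
    (eventually_exists_solution hk hk1 hl hx.1)] with q hq hqk
  obtain ⟨D, y, v, s, hD, hD', hder, ⟨t₀, ht₀, e₀⟩, t₁, ht₁, e₁⟩ := hq hqk.1
  refine ⟨D, fun t => embed C (y t, v t, s t), hD, hD', fun t ht => ?_, ⟨t₀, ht₀, ?_⟩, t₁, ht₁, ?_⟩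
  · obtain ⟨d1, d2, d3, hmem⟩ := hder t ht
    exact ⟨hasDerivAt_embed C ξ d1 d2 d3, embed_mem_curveImage hC hmem⟩
  · simp only [e₀, hx.2]
  · simp only [e₁, hqk.2]

/-- The times at which a solution lies on the curve form a subset of the connected domain that is
relatively closed, as the curve is closed, and open, by uniqueness against the local solutions that
stay on the curve. -/
theorem mem_curveImage_of_onCommonSolution (hC : C ≠ 1) (hk : 0 < k) (hk1 : k ≠ 1) {x z : State}
    (hx : x ∈ curveImage C k) (h : OnCommonSolution (field C ξ) x z) : z ∈ curveImage C k := by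
  obtain ⟨D, φ, hD, hD', hφ, ⟨t₀, ht₀, rfl⟩, t₁, ht₁, rfl⟩ := h
  set u : Set ℂ := {t | t ∈ D ∧ φ t ∈ curveImage C k} with hu
  have hopen : IsOpen u := by
    rw [isOpen_iff_mem_nhds]
    rintro t ⟨ht, hmem⟩
    obtain ⟨D', ψ, hDo, -, hψ, ⟨t', ht', e⟩, -⟩ :=
      (eventually_exists_solution_curveImage ξ hC hk hk1 hmem).self_of_nhds hmem
    -- The system is autonomous, so the local solution may be translated to pass through φ t at time
    -- t.
    have hshift : Tendsto (fun τ : ℂ => τ + (t' - t)) (𝓝 t) (𝓝 t') := by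
      have : Continuous fun τ : ℂ => τ + (t' - t) := by fun_prop
      simpa using this.tendsto t
    have hψ' : ∀ᶠ τ in 𝓝 t, HasDerivAt (fun τ => ψ (τ + (t' - t)))
        (field C ξ (ψ (τ + (t' - t)))) τ ∧ ψ (τ + (t' - t)) ∈ curveImage C k := by
      filter_upwards [hshift.eventually (hDo.mem_nhds ht')] with τ hτ
      exact ⟨(hψ _ hτ).1.comp_add_const τ _, (hψ _ hτ).2⟩
    have heq := eventuallyEq_of_hasDerivAt (contDiff_field C ξ) (t₀ := t)
      ((hD.eventually_mem ht).mono hφ) (hψ'.mono fun _ h => h.1) (by simp [e])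
    filter_upwards [heq, hψ', hD.mem_nhds ht] with τ h1 h2 h3
    exact ⟨h3, h1 ▸ h2.2⟩
  refine (hD'.subset_of_closure_inter_subset hopen ⟨t₀, ht₀, ht₀, hx⟩ ?_ ht₁).2
  rintro t ⟨ht, htD⟩
  refine ⟨htD, ?_⟩
  have : φ t ∈ closure (curveImage C k) :=
    (hφ t htD).continuousAt.continuousWithinAt.mem_closure ht fun τ hτ => hτ.2
  rwa [(isClosed_curveImage C k).closure_eq] at this

theorem phaseCurve_subset_curveImage (hC : C ≠ 1) (hk : 0 < k) (hk1 : k ≠ 1) {x : State}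
    (hx : x ∈ curveImage C k) : phaseCurve (field C ξ) x ⊆ curveImage C k := by
  intro z hz
  induction hz with
  | refl => exact hx
  | tail _ h ih => exact mem_curveImage_of_onCommonSolution ξ hC hk hk1 ih h

/-- A path in the elliptic curve does not leave a phase curve. -/
theorem mem_phaseCurve_of_path (hC : C ≠ 1) (hk : 0 < k) (hk1 : k ≠ 1) (x : State)
    {γ : unitInterval → State} (hγ : Continuous γ) (hmem : ∀ s, γ s ∈ curveImage C k)
    (h0 : γ 0 ∈ phaseCurve (field C ξ) x) (s : unitInterval) :
    γ s ∈ phaseCurve (field C ξ) x := by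
  have hnear : ∀ s, ∀ᶠ s' in 𝓝 s, OnCommonSolution (field C ξ) (γ s) (γ s') := by
    intro s
    filter_upwards [hγ.continuousAt.eventually
      (eventually_exists_solution_curveImage ξ hC hk hk1 (hmem s))] with s' hs'
    obtain ⟨D, φ, hD, hD', hφ, h0, h1⟩ := hs' (hmem s')
    exact ⟨D, φ, hD, hD', fun t ht => (hφ t ht).1, h0, h1⟩
  -- Nearby points of the path share a solution. As this relation is symmetric, both the preimage
  -- and its complement are open.
  have hclopen : IsClopen (γ ⁻¹' phaseCurve (field C ξ) x) := by
    constructor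
    · rw [← isOpen_compl_iff, isOpen_iff_mem_nhds]
      intro s hs
      filter_upwards [hnear s] with s' ⟨D, φ, hD, hD', hφ, h0, h1⟩ hs'
      exact hs (Relation.ReflTransGen.tail hs' ⟨D, φ, hD, hD', hφ, h1, h0⟩)
    · rw [isOpen_iff_mem_nhds]
      intro s hs
      filter_upwards [hnear s] with s' h
      exact Relation.ReflTransGen.tail hs h
  exact Set.eq_univ_iff_forall.1 (hclopen.eq_univ ⟨0, h0⟩) s

end phaseCurve

/-! ### Explicit heteroclinic orbits and the set Ω -/

theorem tendsto_inv_cosh_atTop : Tendsto (fun x => (Real.cosh x)⁻¹) atTop (𝓝 0) := by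
  have hle : ∀ x, (Real.cosh x)⁻¹ ≤ 2 * Real.exp (-x) := by
    intro x
    rw [Real.exp_neg, ← div_eq_mul_inv, inv_le_comm₀ (Real.cosh_pos x) (by positivity), inv_div,
      Real.cosh_eq]
    linarith [Real.exp_pos (-x)]
  refine squeeze_zero (fun x => (inv_pos.2 (Real.cosh_pos x)).le) hle ?_
  simpa using (Real.tendsto_exp_neg_atTop_nhds_zero).const_mul 2

theorem tendsto_inv_cosh_atBot : Tendsto (fun x => (Real.cosh x)⁻¹) atBot (𝓝 0) := by
  simpa [Function.comp_def] using tendsto_inv_cosh_atTop.comp tendsto_neg_atBot_atTop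

theorem tendsto_tanh_atTop : Tendsto Real.tanh atTop (𝓝 1) := by
  have h : ∀ x, Real.tanh x = 1 - Real.exp (-x) * (Real.cosh x)⁻¹ := by
    intro x
    have := (Real.cosh_pos x).ne'
    rw [Real.tanh_eq_sinh_div_cosh, ← Real.cosh_sub_sinh]
    field_simp
    ring
  rw [funext h]
  simpa using (Real.tendsto_exp_neg_atTop_nhds_zero.mul tendsto_inv_cosh_atTop).const_sub 1

theorem tendsto_tanh_atBot : Tendsto Real.tanh atBot (𝓝 (-1)) := by
  simpa [Function.comp_def] using (tendsto_tanh_atTop.comp tendsto_neg_atBot_atTop).neg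

theorem hasDerivAt_tanh_mul (w t : ℝ) : HasDerivAt (fun t => Real.tanh (w * t))
    (w * (Real.cosh (w * t))⁻¹ ^ 2) t := by
  have hc := (Real.cosh_pos (w * t)).ne'
  have hl : HasDerivAt (fun t => w * t) w t := by simpa using (hasDerivAt_id t).const_mul w
  simp only [Real.tanh_eq_sinh_div_cosh]
  refine (hl.sinh.div hl.cosh hc).congr_deriv ?_
  field_simp
  linear_combination w * Real.cosh_sq_sub_sinh_sq (w * t)

theorem hasDerivAt_inv_cosh_mul (w t : ℝ) : HasDerivAt (fun t => (Real.cosh (w * t))⁻¹)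
    (-w * Real.tanh (w * t) * (Real.cosh (w * t))⁻¹) t := by
  have hc := (Real.cosh_pos (w * t)).ne'
  have hl : HasDerivAt (fun t => w * t) w t := by simpa using (hasDerivAt_id t).const_mul w
  refine (hl.cosh.inv hc).congr_deriv ?_
  rw [Real.tanh_eq_sinh_div_cosh]
  field_simp

theorem inv_cosh_sq_add_tanh_sq (x : ℝ) : (Real.cosh x)⁻¹ ^ 2 + Real.tanh x ^ 2 = 1 := by
  have hc := (Real.cosh_pos x).ne'
  rw [Real.tanh_eq_sinh_div_cosh]
  field_simp
  linear_combination -Real.cosh_sq_sub_sinh_sq x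

theorem isRealState_embed (C y v s : ℝ) : IsRealState (embed C (y, v, s)) := by
  intro i
  unfold embed
  split_ifs <;> fin_cases i <;> simp [planarPoint]

theorem embed_mem_hyperbolicEquilibria (C : ℝ) {d : ℝ} (hd : d ^ 2 = 1) :
    embed C ((d : ℝ), (0 : ℝ), (0 : ℝ)) ∈ hyperbolicEquilibria C := by
  unfold embed hyperbolicEquilibria
  rcases (sq_eq_sq_iff_eq_or_eq_neg.1 (hd.trans (one_pow 2).symm)) with rfl | rfl <;> split_ifs <;> simp

/-- The heteroclinic solutions `y = δ tanh (ω t)`, `v = η / cosh (ω t)`, `s = ∓ δ η / cosh (ω t)`. -/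
noncomputable def heteroclinic (C d e t : ℝ) : ℂ × ℂ × ℂ :=
  ((d * Real.tanh (omega C * t) : ℝ), (e * (Real.cosh (omega C * t))⁻¹ : ℝ),
    (-orientation C * d * e * (Real.cosh (omega C * t))⁻¹ : ℝ))

theorem tendsto_embed_heteroclinic {C : ℝ} {d e y : ℝ} {l : Filter ℝ}
    (h1 : Tendsto (fun t => Real.tanh (omega C * t)) l (𝓝 y))
    (h2 : Tendsto (fun t => (Real.cosh (omega C * t))⁻¹) l (𝓝 0)) :
    Tendsto (fun t => embed C (heteroclinic C d e t)) l
      (𝓝 (embed C ((d * y : ℝ), (0 : ℝ), (0 : ℝ)))) := by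
  refine (continuous_embed C).continuousAt.tendsto.comp ?_
  have hr : ∀ {f : ℝ → ℝ} {a : ℝ}, Tendsto f l (𝓝 a) →
      Tendsto (fun t => ((f t : ℝ) : ℂ)) l (𝓝 (a : ℂ)) :=
    fun h => (Complex.continuous_ofReal.tendsto _).comp h
  refine (hr (h1.const_mul d)).prodMk_nhds ((hr ?_).prodMk_nhds (hr ?_))
  · simpa using h2.const_mul e
  · simpa using h2.const_mul (-orientation C * d * e)

theorem tendsto_embed_heteroclinic_atTop {C : ℝ} (hC : C ≠ 1) (d e : ℝ) :
    Tendsto (fun t => embed C (heteroclinic C d e t)) atTop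
      (𝓝 (embed C (d, (0 : ℝ), (0 : ℝ)))) := by
  have hl : Tendsto (fun t => omega C * t) atTop atTop :=
    tendsto_id.const_mul_atTop (omega_pos hC)
  simpa using tendsto_embed_heteroclinic (d := d) (e := e) (tendsto_tanh_atTop.comp hl)
    (tendsto_inv_cosh_atTop.comp hl)

theorem tendsto_embed_heteroclinic_atBot {C : ℝ} (hC : C ≠ 1) (d e : ℝ) :
    Tendsto (fun t => embed C (heteroclinic C d e t)) atBot
      (𝓝 (embed C ((-d : ℝ), (0 : ℝ), (0 : ℝ)))) := by
  have hl : Tendsto (fun t => omega C * t) atBot atBot :=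
    tendsto_id.const_mul_atBot (omega_pos hC)
  simpa using tendsto_embed_heteroclinic (d := d) (e := e) (tendsto_tanh_atBot.comp hl)
    (tendsto_inv_cosh_atBot.comp hl)

theorem embed_heteroclinic_mem_reGamOne {C : ℝ} (hC : C ≠ 1) (ξ : ℝ) {d e : ℝ} (hd : d ^ 2 = 1)
    (he : e ^ 2 = 1) (t : ℝ) : embed C (heteroclinic C d e t) ∈ reGamOne C ξ := by
  have hσ := orientation_sq C
  refine ⟨fun t => embed C (heteroclinic C d e t), fun t => ⟨?_, isRealState_embed C _ _ _⟩,
    fun t => ?_, ⟨_, embed_mem_hyperbolicEquilibria C (d := -d) (by rw [neg_sq, hd]), _,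
      embed_mem_hyperbolicEquilibria C hd, ?_, tendsto_embed_heteroclinic_atBot hC d e,
      tendsto_embed_heteroclinic_atTop hC d e⟩, t, rfl⟩
  · have h := inv_cosh_sq_add_tanh_sq (omega C * t)
    apply embed_mem_surfacePi C (k := 1)
    constructor
    · simp only [heteroclinic]
      norm_cast
      linear_combination h + (Real.tanh (omega C * t)) ^ 2 * hd +
        ((Real.cosh (omega C * t))⁻¹) ^ 2 * he
    · simp only [heteroclinic]
      norm_cast
      linear_combination h + (Real.tanh (omega C * t)) ^ 2 * hd +
        ((Real.cosh (omega C * t))⁻¹) ^ 2 * (d ^ 2 * e ^ 2 * hσ + e ^ 2 * hd + he)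
  · have h1 := hasDerivAt_tanh_mul (omega C) t
    have h2 := hasDerivAt_inv_cosh_mul (omega C) t
    apply hasDerivAt_embed C ξ
    · refine (h1.const_mul d).ofReal_comp.congr_deriv ?_
      norm_cast
      linear_combination (-omega C * (Real.cosh (omega C * t))⁻¹ ^ 2 * d) * (e ^ 2 * hσ + he)
    · refine (h2.const_mul e).ofReal_comp.congr_deriv ?_
      norm_cast
      linear_combination (omega C * (Real.cosh (omega C * t))⁻¹ * Real.tanh (omega C * t) * e) *
        (d ^ 2 * hσ + hd)
    · refine (h2.const_mul (-orientation C * d * e)).ofReal_comp.congr_deriv ?_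
      norm_cast
      ring
  -- The limits have y = -d and y = d, which differ since d² = 1.
  · intro h
    have := congrArg (fun x => (coords C x).1) h
    simp only [coords_embed hC] at this
    norm_cast at this
    have : d = 0 := by linarith
    norm_num [this] at hd

/-- `Ω` contains the two real circles `v = ±s` of the curve `v ^ 2 + y ^ 2 = s ^ 2 + y ^ 2 = 1`. -/
theorem embed_mem_omegaSet {C : ℝ} (hC : C ≠ 1) (ξ : ℝ) {y v s : ℝ} (hv : v ^ 2 + y ^ 2 = 1)
    (hs : s ^ 2 + y ^ 2 = 1) : embed C (y, v, s) ∈ omegaSet C ξ := by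
  -- Here the point is an equilibrium, reached only as a limit of a heteroclinic orbit; this is
  -- where the closure is needed.
  by_cases hy : y ^ 2 = 1
  · have hv0 : v = 0 := pow_eq_zero_iff two_ne_zero |>.1 (by linarith)
    have hs0 : s = 0 := pow_eq_zero_iff two_ne_zero |>.1 (by linarith)
    rw [hv0, hs0]
    exact mem_closure_of_tendsto (tendsto_embed_heteroclinic_atTop hC y 1)
      (Eventually.of_forall fun t => embed_heteroclinic_mem_reGamOne hC ξ hy (one_pow 2) t)
  · apply subset_closure
    have hv0 : v ≠ 0 := by
      rintro rfl; apply hy; linarith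
    have hvpos : 0 < |v| := abs_pos.2 hv0
    have hσ := orientation_sq C
    have hs2 : s ^ 2 = v ^ 2 := by linarith
    -- The signs `e` and `d` select, among the heteroclinic orbits, the one with the sign of v and
    -- the ratio s / v; the time artanh(dy) / ω then gives y.
    set e := v / |v| with he
    have he2 : e ^ 2 = 1 := by rw [he, div_pow, sq_abs, div_self (pow_ne_zero 2 hv0)]
    set d := -orientation C * (s / v) with hd
    have hd2 : d ^ 2 = 1 := by
      rw [hd, mul_pow, neg_sq, hσ, div_pow, hs2, div_self (pow_ne_zero 2 hv0), one_mul]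
    have hdy : (d * y) ^ 2 < 1 := by
      rw [mul_pow, hd2, one_mul]; nlinarith [sq_pos_of_pos hvpos, sq_abs v]
    have hmem : d * y ∈ Set.Ioo (-1 : ℝ) 1 := abs_lt.1 ((sq_lt_one_iff_abs_lt_one _).1 hdy)
    have hω := (omega_pos hC).ne'
    have hcosh : (Real.cosh (Real.artanh (d * y)))⁻¹ = |v| := by
      rw [Real.cosh_artanh hmem, one_div, inv_inv, mul_pow, hd2, one_mul,
        show 1 - y ^ 2 = v ^ 2 by linarith, Real.sqrt_sq_eq_abs]
    have hev : e * |v| = v := by rw [he, div_mul_cancel₀ _ hvpos.ne']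
    convert embed_heteroclinic_mem_reGamOne hC ξ hd2 he2 (Real.artanh (d * y) / omega C) using 2
    rw [heteroclinic, mul_div_cancel₀ _ hω, Real.tanh_artanh hmem, hcosh, ← mul_assoc, ← sq, hd2,
      one_mul, mul_assoc _ e, hev, hd]
    congr 3
    rw [mul_assoc, mul_assoc, div_mul_cancel₀ _ hv0, ← mul_assoc, neg_mul_neg, ← sq, hσ, one_mul]

/-! ### Compactness as k tends to 1 -/

/-- For `k` near `1` the part of the elliptic curve over the segment `[-max 1 k, max 1 k]` lies in
a given neighbourhood of `Ω`. -/
theorem exists_embed_mem_of_near_one {C : ℝ} (hC : C ≠ 1) (ξ : ℝ) {V : Set State} (hV : IsOpen V)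
    (hΩ : omegaSet C ξ ⊆ V) :
    ∃ ε : ℝ, 0 < ε ∧ ε ≤ 1 ∧ ∀ k : ℝ, |k - 1| < ε → ∀ x ∈ curve k, x.1.im = 0 →
      |x.1.re| ≤ max 1 k → embed C x ∈ V := by
  -- `K` collects the bad pairs (k, x), with x over the segment but outside `V`. It is compact, so
  -- its projection to k is closed, and it suffices that k = 1 is not in it.
  let K : Set (ℝ × ℂ × ℂ × ℂ) := ({p | 0 ≤ p.1} ∩ {p | p.1 ≤ 2}) ∩
    (({p | p.2.2.1 ^ 2 + p.2.1 ^ 2 = (p.1 : ℂ) ^ 2} ∩ {p | p.2.2.2 ^ 2 + p.2.1 ^ 2 = 1}) ∩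
    (({p | p.2.1.im = 0} ∩ {p | |p.2.1.re| ≤ max 1 p.1}) ∩ (embed C ∘ Prod.snd) ⁻¹' Vᶜ))
  have hclosed : IsClosed K :=
    ((isClosed_le (by fun_prop) (by fun_prop)).inter (isClosed_le (by fun_prop) (by fun_prop))).inter
      (((isClosed_eq (by fun_prop) (by fun_prop)).inter
        (isClosed_eq (by fun_prop) (by fun_prop))).inter
      (((isClosed_eq (by fun_prop) (by fun_prop)).inter
        (isClosed_le (by fun_prop) (by fun_prop))).inter
      (hV.isClosed_compl.preimage ((continuous_embed C).comp continuous_snd))))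
  -- The constant 3 comes from |w|² ≤ 2² + 2² < 3².
  have hbound : ∀ w y : ℂ, ∀ c : ℝ, |c| ≤ 2 → ‖y‖ ≤ 2 → w ^ 2 + y ^ 2 = (c : ℂ) ^ 2 → ‖w‖ ≤ 3 := by
    intro w y c hc hy h
    have h1 : ‖w‖ ^ 2 ≤ ‖(c : ℂ)‖ ^ 2 + ‖y‖ ^ 2 := by
      rw [← norm_pow, ← norm_pow, ← norm_pow, eq_sub_of_add_eq h]
      exact norm_sub_le _ _
    rw [Complex.norm_real, Real.norm_eq_abs] at h1
    nlinarith [norm_nonneg w, norm_nonneg y, abs_nonneg c]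
  have hcompact : IsCompact K := by
    refine Metric.isCompact_of_isClosed_isBounded hclosed
      ((Metric.isBounded_closedBall (x := 0) (r := 3)).subset ?_)
    rintro ⟨k, y, v, s⟩ ⟨⟨hk0, hk2⟩, ⟨h1, h2⟩, ⟨him, hre⟩, -⟩
    change 0 ≤ k at hk0
    change k ≤ 2 at hk2
    change v ^ 2 + y ^ 2 = (k : ℂ) ^ 2 at h1
    change s ^ 2 + y ^ 2 = 1 at h2
    change y.im = 0 at him
    change |y.re| ≤ max 1 k at hre
    have hy : ‖y‖ ≤ 2 := by
      rw [← Complex.abs_re_eq_norm.2 him]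
      exact hre.trans (max_le one_le_two hk2)
    have hv := hbound v y k (by rwa [abs_of_nonneg hk0]) hy h1
    have hs := hbound s y 1 (by norm_num) hy (by simpa using h2)
    rw [mem_closedBall_zero_iff, Prod.norm_def, Prod.norm_def, Prod.norm_def]
    refine max_le ?_ (max_le (by simpa using hy.trans (by norm_num)) (max_le hv hs))
    rw [Real.norm_eq_abs, abs_of_nonneg hk0]
    linarith
  have hone : (1 : ℝ) ∉ Prod.fst '' K := by
    rintro ⟨⟨k, y, v, s⟩, ⟨-, ⟨h1, h2⟩, ⟨him, hre⟩, hVc⟩, hk⟩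
    change k = 1 at hk
    subst hk
    change v ^ 2 + y ^ 2 = ((1 : ℝ) : ℂ) ^ 2 at h1
    change s ^ 2 + y ^ 2 = 1 at h2
    change y.im = 0 at him
    change |y.re| ≤ max 1 1 at hre
    apply hVc
    apply hΩ
    have hyre : y = (y.re : ℂ) := Complex.ext rfl (by simp [him])
    have hy1 : y.re ^ 2 ≤ 1 := by
      rw [max_self] at hre
      exact (sq_le_one_iff_abs_le_one _).2 hre
    -- For k = 1 the segment is [-1, 1], where 1 - y² ≥ 0; so both roots are real and the point lies
    -- on a real circle.
    have hreal : ∀ w : ℂ, w ^ 2 + y ^ 2 = 1 → w = (w.re : ℂ) ∧ w.re ^ 2 + y.re ^ 2 = 1 := by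
      intro w hw
      rw [hyre] at hw
      have hr := congrArg Complex.re hw
      have hi := congrArg Complex.im hw
      simp [sq] at hr hi
      have him0 : w.im = 0 := by
        have h0 : w.re * w.im = 0 := by linarith
        rcases mul_eq_zero.1 h0 with h | h
        · rw [h] at hr; nlinarith
        · exact h
      rw [him0] at hr
      exact ⟨Complex.ext rfl (by simp [him0]), by linarith⟩
    obtain ⟨ev, hv⟩ := hreal v (by simpa using h1)
    obtain ⟨es, hs⟩ := hreal s h2
    rw [hyre, ev, es]
    exact embed_mem_omegaSet hC ξ hv hs
  obtain ⟨ε, hε, hball⟩ := Metric.isOpen_iff.1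
    (hcompact.image continuous_fst).isClosed.isOpen_compl 1 hone
  refine ⟨min ε 1, lt_min hε one_pos, min_le_right _ _, fun k hk x hx him hre => ?_⟩
  by_contra hxV
  have hk1 := abs_lt.1 (hk.trans_le (min_le_right _ _))
  refine hball (a := k) ?_ ⟨(k, x), ⟨⟨(by linarith : 0 ≤ k), (by linarith : k ≤ 2)⟩, hx, ⟨him, hre⟩, hxV⟩, rfl⟩
  rw [Metric.mem_ball, Real.dist_eq]
  exact hk.trans_le (min_le_left _ _)

/-! ### The theorem -/

theorem initialPoint_eq_embed (C k : ℝ) :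
    initialPoint C k = embed C (0, k, -(orientation C : ℂ)) := by
  unfold initialPoint embed orientation
  split_ifs <;> simp

end Satellite

open Satellite in
theorem mainTheorem7 (C ξ : ℝ) (hC0 : 0 < C) (hC1 : C ≠ 1) (U : Set Satellite.State)
    (hU : Satellite.IsNeighbourhoodInPi U (Satellite.omegaSet C ξ)) :
    ∃ ε : ℝ, 0 < ε ∧ ∀ k : ℝ, 0 < |k - 1| → |k - 1| < ε →
      Satellite.GeneratedByLoopsIn (Satellite.Gam C ξ k) U := by
  obtain ⟨-, V, hV, hΩ, hVU⟩ := hU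
  obtain ⟨ε, hε, hε1, hnear⟩ := exists_embed_mem_of_near_one hC1 ξ hV hΩ
  refine ⟨ε, hε, fun k hk0 hkε => ?_⟩
  have hk : 0 < k := by linarith [(abs_lt.1 (hkε.trans_le hε1)).1]
  have hk1 : k ≠ 1 := fun h => by simp [h] at hk0
  have hx₀ : ((0, k, -(orientation C : ℂ)) : ℂ × ℂ × ℂ) ∈ curve k := by
    refine ⟨by simp, ?_⟩
    have := orientation_sq C
    simp only
    norm_cast
    linear_combination this
  have hinit : initialPoint C k ∈ curveImage C k := by
    rw [initialPoint_eq_embed]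
    exact embed_mem_curveImage hC1 hx₀
  have hsub : Gam C ξ k ⊆ curveImage C k := phaseCurve_subset_curveImage ξ hC1 hk hk1 hinit
  -- The track of a point under the deformation is a path in the elliptic curve that starts on the
  -- phase curve, hence remains on it.
  have hstay : ∀ x ∈ Gam C ξ k, ∀ t : unitInterval,
      embed C (deform k t (coords C x)) ∈ Gam C ξ k := by
    intro x hx t
    have hxc := hsub hx
    refine mem_phaseCurve_of_path ξ hC1 hk hk1 (initialPoint C k)
      (γ := fun t : unitInterval => embed C (deform k t (coords C x)))
      ((continuous_embed C).comp (continuous_deform hk continuous_subtype_val continuous_const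
        (fun a => a.2.1) (fun a => a.2.2) fun _ => hxc.1))
      (fun s => embed_mem_curveImage hC1 (deform_mem_curve hk s.2.1 s.2.2 hxc.1)) ?_ t
    change embed C (deform k ((0 : unitInterval) : ℝ) (coords C x)) ∈ Gam C ξ k
    rwa [Set.Icc.coe_zero, deform_zero_left hxc.1, hxc.2]
  refine generatedByLoopsIn_of_homotopy ⟨initialPoint C k, Relation.ReflTransGen.refl⟩
    (fun a => ⟨embed C (deform k a.1 (coords C a.2)), hstay a.2 a.2.2 a.1⟩) ?_ ?_ ?_ ?_
  · refine Continuous.subtype_mk ((continuous_embed C).comp (continuous_deform hk (by fun_prop)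
      ((continuous_coords C).comp (by fun_prop)) (fun a => a.1.2.1) (fun a => a.1.2.2)
      fun a => (hsub a.2.2).1)) _
  · intro x
    apply Subtype.ext
    simp [deform_zero_left (hsub x.2).1, (hsub x.2).2]
  · intro t
    apply Subtype.ext
    simp only [initialPoint_eq_embed, coords_embed hC1, deform_of_fst_eq_zero hk hx₀ rfl]
  · intro x
    have hmem := deform_mem_curve hk zero_le_one le_rfl (hsub x.2).1
    exact hVU ⟨hnear k hkε _ hmem deform_one_fst_im abs_deform_one_fst_re_le,
      embed_mem_surfacePi C hmem⟩
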